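/- Let $r$ and $\ell$ be positive integers and let $c=(c_1,\dots,c_r)$ be a profile, i.e. a sequence of non-negative integers with $c_1+\cdots+c_r=\ell$. A cylindric partition with profile $c$ is a sequence $\Lambda=(\lambda^{(1)},\dots,\lambda^{(r)})$ of partitions such that, with missing parts read as zeros, $\lambda^{(i)}_j\ge\lambda^{(i+1)}_{j+c_{i+1}}$ for $1\le i<r$ and $\lambda^{(r)}_j\ge\lambda^{(1)}_{j+c_1}$, for all $j\ge 1$. Its size is the sum of all parts of all the $\lambda^{(i)}$, and it is into distinct parts if no positive integer occurs more than once among all these parts. Let $\mathcal D_c(n)$ be the number of cylindric partitions of size $n$ with profile $c$ into distinct parts, and for complex $q$ with $|q|<1$ put $D_c(q)=\sum_{n\ge0}\mathcal D_c(n)q^n$ and $(a;q)_\infty=\prod_{n\ge0}(1-aq^n)$. Theorem. For every profile $c$ there exist a polynomial $rg_c\in\mathbb C[x]$, $k\in\mathbb N$, $B_0,\dots,B_k\in\mathbb N$ and complex numbers $\alpha_i^m,\beta_i^m$ ($0\le m\le k$, $1\le i\le B_m$), all depending only on $c$, such that for all complex $q$ with $|q|<1$ the series $D_c(q)$ converges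 and $$D_c(q)=rg_c(q)+\sum_{m=0}^{k}\sum_{i=1}^{B_m}\alpha_i^m\left[\left(z\frac{\mathrm d}{\mathrm dz}\right)^{m}(-\beta_i^m zq;q)_\infty\right]_{z=1}.$$ Moreover, the terms on the right are infinite products, or infinite products multiplied by polynomials in Lambert series: for every $m\ge0$ there is a polynomial $P_m\in\mathbb Z[x_1,\dots,x_m]$ such that for all complex $\beta,q$ with $|q|<1$ and $1+\beta q^n\ne0$ for all $n\ge1$, $$\left[\left(z\frac{\mathrm d}{\mathrm dz}\right)^{m}(-\beta zq;q)_\infty\right]_{z=1}=(-\beta q;q)_\infty\,P_m(L_1,\dots,L_m),\qquad L_j=\sum_{n\ge1}\left(\frac{\beta q^n}{1+\beta q^n}\right)^j .$$ -/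

import Mathlib

/-- A cylindric partition of rank `r` with profile `c = (c 0, …, c (r - 1))`. The `i`-th partition is
the weakly decreasing, finitely supported sequence `part i 0 ≥ part i 1 ≥ …` of natural numbers; its
parts are the nonzero entries, and missing entries are zeros. Addition in `Fin r` is cyclic, so the
field `interlace` also contains the condition that links the last partition to the first. -/
@[ext]
structure CylindricPartition {r : ℕ} [NeZero r] (c : Fin r → ℕ) where
  /-- the entries of the partitions -/
  part : Fin r → ℕ →₀ ℕ
  antitone_part : ∀ i, Antitone (part i)
  interlace : ∀ i j, part (i + 1) (j + c (i + 1)) ≤ part i j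

namespace CylindricPartition

variable {r : ℕ} [NeZero r] {c : Fin r → ℕ}

/-- The sum of all the parts. -/
def size (Λ : CylindricPartition c) : ℕ := ∑ i, (Λ.part i).sum fun _ p => p

/-- No positive integer occurs twice as a part, within one of the partitions or across them. -/
def HasDistinctParts (Λ : CylindricPartition c) : Prop :=
  ∀ i j i' j', Λ.part i j ≠ 0 → Λ.part i j = Λ.part i' j' → i = i' ∧ j = j'

/-- There are finitely many cylindric partitions of given profile and size. -/
theorem finite_size_eq (c : Fin r → ℕ) (n : ℕ) :
    {Λ : CylindricPartition c | Λ.size = n}.Finite := by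
  classical
  have entry : ∀ Λ : CylindricPartition c, ∀ i j, Λ.part i j ≤ Λ.size := by
    intro Λ i j
    by_cases h : Λ.part i j = 0
    · omega
    · calc Λ.part i j ≤ (Λ.part i).sum fun _ p => p :=
            Finset.single_le_sum (f := fun j => Λ.part i j) (fun _ _ => Nat.zero_le _)
              (Finsupp.mem_support_iff.2 h)
        _ ≤ Λ.size := Finset.single_le_sum (f := fun i => (Λ.part i).sum fun _ p => p)
              (fun _ _ => Nat.zero_le _) (Finset.mem_univ i)
  have vanish : ∀ Λ : CylindricPartition c, ∀ i j, Λ.size ≤ j → Λ.part i j = 0 := by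
    intro Λ i j hj
    by_contra h
    have hsub : Finset.range (j + 1) ⊆ (Λ.part i).support := by
      intro k hk
      have := Λ.antitone_part i (Nat.lt_succ_iff.1 (Finset.mem_range.1 hk))
      rw [Finsupp.mem_support_iff]
      omega
    have h1 : j + 1 ≤ (Λ.part i).sum fun _ p => p := by
      calc j + 1 = ∑ _k ∈ Finset.range (j + 1), 1 := by simp
        _ ≤ ∑ k ∈ Finset.range (j + 1), Λ.part i k := Finset.sum_le_sum fun k hk => by
            have := Finsupp.mem_support_iff.1 (hsub hk)
            omega
        _ ≤ (Λ.part i).sum fun _ p => p := Finset.sum_le_sum_of_subset hsub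
    have h2 : ((Λ.part i).sum fun _ p => p) ≤ Λ.size :=
      Finset.single_le_sum (f := fun i => (Λ.part i).sum fun _ p => p)
        (fun _ _ => Nat.zero_le _) (Finset.mem_univ i)
    omega
  refine Set.Finite.of_finite_image (f := fun Λ : CylindricPartition c =>
    fun (i : Fin r) (j : Fin n) => (Fin.ofNat (n + 1) (Λ.part i j))) (Set.toFinite _) ?_
  intro Λ hΛ M hM h
  have hΛ' : Λ.size = n := hΛ
  have hM' : M.size = n := hM
  ext i j
  by_cases hj : j < n
  · have := congrArg Fin.val (congrFun (congrFun h i) ⟨j, hj⟩)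
    simp only [Fin.val_ofNat] at this
    rwa [Nat.mod_eq_of_lt (by have := entry Λ i j; omega),
      Nat.mod_eq_of_lt (by have := entry M i j; omega)] at this
  · rw [vanish Λ i j (by omega), vanish M i j (by omega)]

/-- The number of cylindric partitions of `n` with profile `c` into distinct parts. -/
noncomputable def distinctCount (c : Fin r → ℕ) (n : ℕ) : ℕ :=
  {Λ : CylindricPartition c | Λ.size = n ∧ Λ.HasDistinctParts}.ncard

end CylindricPartition

/-- The infinite `q`-Pochhammer symbol `(a; q)_∞ = ∏_{n ≥ 0} (1 - a q ^ n)`, for `‖q‖ < 1`. -/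
noncomputable def qPochhammerInf (a q : ℂ) : ℂ := ∏' n : ℕ, (1 - a * q ^ n)

theorem multipliable_qPochhammerInf (a : ℂ) {q : ℂ} (hq : ‖q‖ < 1) :
    Multipliable fun n : ℕ => 1 - a * q ^ n := by
  simp only [sub_eq_add_neg]
  apply multipliable_one_add_of_summable
  simp only [norm_neg, norm_mul, norm_pow]
  exact (summable_geometric_of_lt_one (norm_nonneg q) hq).mul_left _

/-- For `‖q‖ < 1` the function `a ↦ (a; q)_∞` is entire. -/
theorem differentiable_qPochhammerInf {q : ℂ} (hq : ‖q‖ < 1) :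
    Differentiable ℂ fun a => qPochhammerInf a q := by
  intro a
  have hl : HasProdLocallyUniformlyOn (fun (n : ℕ) (x : ℂ) => 1 + -(x * q ^ n))
      (fun x => ∏' n : ℕ, (1 + -(x * q ^ n))) (Metric.ball (0 : ℂ) (‖a‖ + 1)) := by
    refine Summable.hasProdLocallyUniformlyOn_nat_one_add Metric.isOpen_ball
      (u := fun n => (‖a‖ + 1) * ‖q‖ ^ n)
      ((summable_geometric_of_lt_one (norm_nonneg q) hq).mul_left _) ?_ ?_
    · refine Filter.Eventually.of_forall fun n x hx => ?_
      rw [norm_neg, norm_mul, norm_pow]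
      have : ‖x‖ ≤ ‖a‖ + 1 := by simpa using (mem_ball_zero_iff.1 hx).le
      gcongr
    · intro n
      fun_prop
  have hd := hl.tendstoLocallyUniformlyOn_finsetRange.differentiableOn
    (Filter.Eventually.of_forall fun N => by fun_prop) Metric.isOpen_ball
  have := hd.differentiableAt (x := a) (Metric.isOpen_ball.mem_nhds (by simp))
  simpa only [qPochhammerInf, sub_eq_add_neg] using this

/-- The operator `z d/dz`. -/
noncomputable def zDeriv (f : ℂ → ℂ) : ℂ → ℂ := fun z => z * deriv f z

/-- The value at `z = 1` of `(z d/dz) ^ m` applied to the function `z ↦ (-β z q; q)_∞`. -/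
noncomputable def productTerm (m : ℕ) (β q : ℂ) : ℂ :=
  (zDeriv^[m] fun z => qPochhammerInf (-(β * z * q)) q) 1

/-- The Lambert series `∑_{n ≥ 1} (β q ^ n / (1 + β q ^ n)) ^ j`, for `j ≥ 1`. -/
noncomputable def lambertSeries (j : ℕ) (β q : ℂ) : ℂ :=
  ∑' n : ℕ, (β * q ^ (n + 1) / (1 + β * q ^ (n + 1))) ^ j

theorem summable_lambertSeries {j : ℕ} (hj : 1 ≤ j) (β : ℂ) {q : ℂ} (hq : ‖q‖ < 1) :
    Summable fun n : ℕ => (β * q ^ (n + 1) / (1 + β * q ^ (n + 1))) ^ j := by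
  have hs : Summable fun n : ℕ => ‖β * q ^ (n + 1)‖ := by
    simp only [norm_mul, norm_pow, pow_succ]
    exact ((summable_geometric_of_lt_one (norm_nonneg q) hq).mul_right _).mul_left _
  refine Summable.of_norm_bounded_eventually_nat (hs.mul_left 2) ?_
  filter_upwards [hs.tendsto_atTop_zero.eventually (gt_mem_nhds (show (0 : ℝ) < 1 / 2 by norm_num))]
    with n hn
  set x : ℂ := β * q ^ (n + 1)
  have h1 : 1 / 2 ≤ ‖1 + x‖ := by
    have := norm_sub_norm_le (1 : ℂ) (-x)
    rw [norm_one, norm_neg, sub_neg_eq_add] at this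
    linarith
  have h2 : ‖x / (1 + x)‖ ≤ 2 * ‖x‖ := by
    rw [norm_div, div_le_iff₀ (by linarith)]
    nlinarith [norm_nonneg x]
  rw [norm_pow]
  exact (pow_le_of_le_one (norm_nonneg _) (by linarith) (by omega)).trans h2

/-! In a cylindric partition into distinct parts, the largest part must be the first entry of some
`λ^(i)` with `c_i > 0`: were `c_i = 0`, interlacing would repeat it in the preceding partition.
Deleting it leaves a cylindric partition whose profile has one unit moved from position `i` to `i +
1`, and each such step can be reversed. Hence the cylindric partitions with a prescribed set `S` of
parts correspond to walks of length `|S|` from `c` in the finite graph of profiles of the same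
level; their number depends only on `|S|` (`finite_and_card_distinctWithParts`).

The adjacency matrix of this graph is normal (`profileMatrix_normal`), hence diagonalizable, so the
number of walks of length `m` is a combination `∑ a_i b_i ^ m`. Summing `b ^ |S| q ^ (weight of S)`
over all finite `S` gives `(-bq; q)_∞`. Thus the formula holds with zero polynomial and with `m = 0`
alone.

For the second claim, put `w = βz`. The logarithmic derivative gives `w d/dw (-wq; q)_∞ = (-wq; q)_∞
L_1`, and `w dL_j/dw = j (L_j - L_{j+1})`; induction on `m` then yields the polynomials. -/

/-! ### Powers of normal matrices. -/

/-- `ExpSum g` says that the sequence `g` is a finite linear combination of geometric sequences. -/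
def ExpSum (g : ℕ → ℂ) : Prop :=
  ∃ (N : ℕ) (a b : ℕ → ℂ), ∀ m, g m = ∑ i ∈ Finset.range N, a i * b i ^ m

theorem ExpSum.zero : ExpSum fun _ => 0 := ⟨0, 0, 0, fun m => by simp⟩

theorem ExpSum.geometric (a b : ℂ) : ExpSum fun m => a * b ^ m :=
  ⟨1, fun _ => a, fun _ => b, fun m => by simp⟩

theorem ExpSum.add {g h : ℕ → ℂ} (hg : ExpSum g) (hh : ExpSum h) : ExpSum (g + h) := by
  obtain ⟨N, a, b, H⟩ := hg
  obtain ⟨N', a', b', H'⟩ := hh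
  refine ⟨N + N', fun i => if i < N then a i else a' (i - N),
    fun i => if i < N then b i else b' (i - N), fun m => ?_⟩
  rw [Finset.sum_range_add, Pi.add_apply, H, H']
  congr 1
  · refine Finset.sum_congr rfl fun i hi => ?_
    simp [Finset.mem_range.1 hi]
  · simp

/-- The matrix coefficients of the powers of a normal matrix are linear combinations of geometric
sequences. -/
theorem Matrix.expSum_of_normal {V : Type*} [Fintype V] [DecidableEq V] (A : Matrix V V ℂ)
    (hA : A * A.conjTranspose = A.conjTranspose * A) (x : V → ℂ) (s : V) :
    ExpSum fun m => (A ^ m).mulVec x s := by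
  -- Up to scalars, `H` and `K` are the real and imaginary parts of `A`. They are Hermitian, and
  -- they commute because `A` is normal, so their joint eigenspaces span; a joint eigenvector for
  -- `a`, `b` is an eigenvector of `A` for `(a - ib) / 2`.
  set H : Matrix V V ℂ := A + A.conjTranspose with hH
  set K : Matrix V V ℂ := Complex.I • (A - A.conjTranspose) with hK
  have hHh : H.IsHermitian := by
    simp [Matrix.IsHermitian, hH, add_comm]
  have hKh : K.IsHermitian := by
    simp only [Matrix.IsHermitian, hK, Matrix.conjTranspose_smul, Matrix.conjTranspose_sub,
      Matrix.conjTranspose_conjTranspose, RCLike.star_def, Complex.conj_I, neg_smul, ← smul_neg,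
      neg_sub]
  have hHK : Commute H K := by
    refine Commute.smul_right ?_ _
    simp only [hH, Commute, SemiconjBy, add_mul, mul_add, mul_sub, sub_mul, hA]
    abel
  have hA2 : A = (1 / 2 : ℂ) • (H - Complex.I • K) := by
    rw [hH, hK, smul_smul, Complex.I_mul_I]
    module
  have htop := LinearMap.IsSymmetric.iSup_iSup_eigenspace_inf_eigenspace_eq_top_of_commute
    (Matrix.isSymmetric_toEuclideanLin_iff.2 hHh) (Matrix.isSymmetric_toEuclideanLin_iff.2 hKh)
    (by
      have := hHK.map (Matrix.toLinAlgEquiv (EuclideanSpace.basisFun V ℂ).toBasis)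
      rw [commute_iff_eq] at this ⊢
      exact this)
  have key : ∀ v : EuclideanSpace ℂ V, ExpSum fun m => (A ^ m).mulVec v.ofLp s := by
    intro v
    have hv : v ∈ (⊤ : Submodule ℂ (EuclideanSpace ℂ V)) := trivial
    rw [← htop] at hv
    have hadd : ∀ v w : EuclideanSpace ℂ V, (ExpSum fun m => (A ^ m).mulVec v.ofLp s) →
        (ExpSum fun m => (A ^ m).mulVec w.ofLp s) →
        ExpSum fun m => (A ^ m).mulVec (v + w).ofLp s := by
      intro v w h1 h2
      convert h1.add h2 using 1
      ext m
      simp [Matrix.mulVec_add]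
    have hzero : ExpSum fun m => (A ^ m).mulVec (0 : EuclideanSpace ℂ V).ofLp s := by
      simpa using ExpSum.zero
    induction hv using Submodule.iSup_induction' with
    | zero => exact hzero
    | add v w _ _ h1 h2 => exact hadd v w h1 h2
    | mem a v hv =>
      induction hv using Submodule.iSup_induction' with
      | zero => exact hzero
      | add v w _ _ h1 h2 => exact hadd v w h1 h2
      | mem b v hv =>
        have h1 : H.mulVec v.ofLp = a • v.ofLp :=
          congrArg WithLp.ofLp (Module.End.mem_eigenspace_iff.1 hv.1)
        have h2 : K.mulVec v.ofLp = b • v.ofLp :=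
          congrArg WithLp.ofLp (Module.End.mem_eigenspace_iff.1 hv.2)
        have h3 : A.mulVec v.ofLp = ((1 / 2 : ℂ) * (a - Complex.I * b)) • v.ofLp := by
          conv_lhs => rw [hA2]
          rw [Matrix.smul_mulVec, Matrix.sub_mulVec, Matrix.smul_mulVec, h1, h2]
          module
        have h4 : ∀ m : ℕ, (A ^ m).mulVec v.ofLp =
            ((1 / 2 : ℂ) * (a - Complex.I * b)) ^ m • v.ofLp := by
          intro m
          induction m with
          | zero => simp
          | succ m ih =>
            rw [pow_succ', ← Matrix.mulVec_mulVec, ih, Matrix.mulVec_smul, h3, smul_smul, pow_succ]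
        simp only [h4, Pi.smul_apply, smul_eq_mul]
        simpa only [mul_comm] using ExpSum.geometric (v.ofLp s) ((1 / 2 : ℂ) * (a - Complex.I * b))
  simpa using key (WithLp.toLp 2 x)

/-! ### The graph of profiles and its walks. -/

/-- The profiles of length `r` and level `ℓ`. -/
abbrev Profile (r ℓ : ℕ) : Type := ↥(Finset.piAntidiag (Finset.univ : Finset (Fin r)) ℓ)

theorem Profile.sum_eq {r ℓ : ℕ} (s : Profile r ℓ) : ∑ k, s.1 k = ℓ :=
  (Finset.mem_piAntidiag.1 s.2).1

section ProfileGraph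

variable {r : ℕ} [NeZero r]

/-- The profile obtained from `c` by moving one unit from position `i` to position `i + 1`. -/
def moveUnit (c : Fin r → ℕ) (i : Fin r) : Fin r → ℕ :=
  fun k => c k + (if k = i + 1 then 1 else 0) - (if k = i then 1 else 0)

/-- `UnitStep i s t` says that `t` arises from `s` by moving one unit from position `i` to
position `i + 1`. -/
def UnitStep (i : Fin r) (s t : Fin r → ℕ) : Prop :=
  0 < s i ∧ ∀ k, s k + (if k = i + 1 then 1 else 0) = t k + (if k = i then 1 else 0)

theorem unitStep_iff {i : Fin r} {s t : Fin r → ℕ} :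
    UnitStep i s t ↔ 0 < s i ∧ t = moveUnit s i := by
  refine and_congr_right fun h => ?_
  rw [funext_iff]
  refine forall_congr' fun k => ?_
  unfold moveUnit
  by_cases hk : k = i
  · subst hk
    split_ifs <;> omega
  · split_ifs <;> omega

theorem UnitStep.sum_eq {i : Fin r} {s t : Fin r → ℕ} (h : UnitStep i s t) :
    ∑ k, t k = ∑ k, s k := by
  have := Finset.sum_congr rfl fun k (_ : k ∈ Finset.univ) => h.2 k
  simp only [Finset.sum_add_distrib, Finset.sum_ite_eq', Finset.mem_univ, if_true] at this
  omega

theorem sum_moveUnit {c : Fin r → ℕ} {i : Fin r} (h : 0 < c i) :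
    ∑ k, moveUnit c i k = ∑ k, c k :=
  (unitStep_iff.2 ⟨h, rfl⟩ : UnitStep i c (moveUnit c i)).sum_eq

theorem exists_unitStep_to {i : Fin r} {t : Fin r → ℕ} (h : 0 < t (i + 1)) :
    ∃ s, UnitStep i s t := by
  refine ⟨fun k => t k + (if k = i then 1 else 0) - (if k = i + 1 then 1 else 0), ?_, fun k => ?_⟩
  · by_cases hi : i = i + 1
    · rw [← hi] at h
      simp only [if_true, ← hi]
      omega
    · simp [hi]
  · by_cases hk : k = i + 1
    · subst hk
      dsimp only
      split_ifs <;> omega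
    · simp [hk]

theorem UnitStep.target_pos {i : Fin r} {s t : Fin r → ℕ} (h : UnitStep i s t) :
    0 < t (i + 1) := by
  have h1 := h.1
  have h2 := h.2 (i + 1)
  by_cases hi : i + 1 = i
  · have h2' : s i = t i := by simpa [hi] using h2
    rw [hi, ← h2']
    exact h1
  · simp only [hi, if_true, if_false] at h2
    omega

theorem UnitStep.left_unique {i : Fin r} {s s' t : Fin r → ℕ} (h : UnitStep i s t)
    (h' : UnitStep i s' t) : s = s' := by
  ext k
  have := h.2 k
  have := h'.2 k
  omega

theorem UnitStep.right_unique {i : Fin r} {s t t' : Fin r → ℕ} (h : UnitStep i s t)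
    (h' : UnitStep i s t') : t = t' := by
  ext k
  have := h.2 k
  have := h'.2 k
  omega

/-- Moves at distinct positions draw on different units, so a square of two moves can be completed
from either corner. A common target `u` corresponds to the common source obtained from `s` by
undoing the move at `j`. -/
theorem exists_unitStep_comm_of_ne {i j : Fin r} (hij : i ≠ j) (s t : Fin r → ℕ) :
    (∃ u, UnitStep i s u ∧ UnitStep j t u) ↔ ∃ u, UnitStep j u s ∧ UnitStep i u t := by
  have hj : i + 1 ≠ j + 1 := fun h => hij (add_right_cancel h)
  -- Two distinct positions exist, so `r ≥ 2` and no move is a loop.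
  have hr : ∀ k : Fin r, k + 1 ≠ k := by
    intro k hk
    have h1 : (1 : Fin r) = 0 := by simpa using hk
    have : ∀ x : Fin r, x = 0 := by
      intro x
      have hr := NeZero.pos r
      rcases r with _ | _ | r
      · omega
      · exact Fin.ext (by have := x.isLt; have := (0 : Fin (0 + 1)).isLt; omega)
      · simp at h1
    exact hij ((this i).trans (this j).symm)
  constructor
  · rintro ⟨u, h1, h2⟩
    have hs : 0 < s (j + 1) := by
      have := h1.2 (j + 1)
      have := h2.target_pos
      rw [if_neg hj.symm] at *
      omega
    obtain ⟨w, hw⟩ := exists_unitStep_to hs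
    refine ⟨w, hw, ?_, fun k => ?_⟩
    · have h3 := hw.2 i
      have h4 := h1.2 i
      have h5 := h2.2 i
      rw [if_neg hij] at h3 h5
      rw [if_neg (hr i).symm, if_pos rfl] at h4
      omega
    · have := hw.2 k
      have := h1.2 k
      have := h2.2 k
      omega
  · rintro ⟨u, h1, h2⟩
    have hs : 0 < s i := by
      have := h1.2 i
      have := h2.1
      rw [if_neg hij] at *
      omega
    refine ⟨moveUnit s i, unitStep_iff.2 ⟨hs, rfl⟩, ?_, fun k => ?_⟩
    · have := h2.2 j
      have := h1.1
      rw [if_neg hij.symm] at *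
      omega
    · have := h1.2 k
      have := h2.2 k
      have := (unitStep_iff.2 ⟨hs, rfl⟩ : UnitStep i s (moveUnit s i)).2 k
      omega

/-- Both sides say that `s = t` and that position `i + 1` is occupied: a unit can leave `i + 1`
exactly when one could have arrived there from `i`. -/
theorem exists_unitStep_self_comm (i : Fin r) (s t : Fin r → ℕ) :
    (∃ u, UnitStep (i + 1) s u ∧ UnitStep (i + 1) t u) ↔ ∃ u, UnitStep i u s ∧ UnitStep i u t := by
  constructor
  · rintro ⟨u, h1, h2⟩
    obtain rfl := h1.left_unique h2
    obtain ⟨w, hw⟩ := exists_unitStep_to h1.1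
    exact ⟨w, hw, hw⟩
  · rintro ⟨u, h1, h2⟩
    obtain rfl := h1.right_unique h2
    have := unitStep_iff.2 ⟨h1.target_pos, rfl⟩
    exact ⟨_, this, this⟩

open Classical in
/-- The adjacency matrix of the graph of profiles: an entry counts the unit moves from one profile
to another. -/
noncomputable def profileMatrix (r ℓ : ℕ) [NeZero r] : Matrix (Profile r ℓ) (Profile r ℓ) ℂ :=
  fun s t => ∑ i, if UnitStep i s.1 t.1 then 1 else 0

theorem Finset.sum_ite_one_eq_ite_exists {ι : Type*} [Fintype ι] (p : ι → Prop) [DecidablePred p]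
    [Decidable (∃ u, p u)] (h : ∀ u v, p u → p v → u = v) :
    ∑ u, (if p u then (1 : ℂ) else 0) = if ∃ u, p u then 1 else 0 := by
  split_ifs with hp
  · obtain ⟨u, hu⟩ := hp
    rw [Finset.sum_eq_single u (fun v _ hv => if_neg fun hpv => hv (h v u hpv hu)) (by simp),
      if_pos hu]
  · push Not at hp
    simp [hp]

-- The entry at `(s, t)` of `A Aᴴ` counts pairs of moves from `s` and `t` to a common target, and
-- that of `Aᴴ A` pairs from a common source. Pairs at distinct positions match after swapping `i`
-- and `j`. Pairs at equal positions match only after the cyclic shift `i ↦ i + 1`, hence only in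
-- the sum over `i`.
open Classical in
theorem profileMatrix_normal (r ℓ : ℕ) [NeZero r] :
    profileMatrix r ℓ * (profileMatrix r ℓ).conjTranspose =
      (profileMatrix r ℓ).conjTranspose * profileMatrix r ℓ := by
  ext s t
  set F : Fin r → Fin r → ℂ :=
    fun i j => if ∃ u, UnitStep i s.1 u ∧ UnitStep j t.1 u then 1 else 0 with hF
  set G : Fin r → Fin r → ℂ :=
    fun i j => if ∃ u, UnitStep i u s.1 ∧ UnitStep j u t.1 then 1 else 0 with hG
  have h1 : (profileMatrix r ℓ * (profileMatrix r ℓ).conjTranspose) s t = ∑ i, ∑ j, F i j := by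
    simp only [Matrix.mul_apply, Matrix.conjTranspose_apply, profileMatrix, star_sum,
      apply_ite (star : ℂ → ℂ), star_one, star_zero, Finset.sum_mul_sum, ite_mul, one_mul,
      zero_mul, ← ite_and]
    rw [Finset.sum_comm]
    refine Finset.sum_congr rfl fun i _ => ?_
    rw [Finset.sum_comm]
    refine Finset.sum_congr rfl fun j _ => ?_
    rw [Finset.sum_ite_one_eq_ite_exists _
      fun u v hu hv => Subtype.ext (hu.1.right_unique hv.1)]
    refine if_congr ⟨fun ⟨u, hu⟩ => ⟨u.1, hu⟩, fun ⟨u, hu⟩ => ⟨⟨u, ?_⟩, hu⟩⟩ rfl rfl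
    simp [Finset.mem_piAntidiag, hu.1.sum_eq, s.sum_eq]
  have h2 : ((profileMatrix r ℓ).conjTranspose * profileMatrix r ℓ) s t = ∑ i, ∑ j, G i j := by
    simp only [Matrix.mul_apply, Matrix.conjTranspose_apply, profileMatrix, star_sum,
      apply_ite (star : ℂ → ℂ), star_one, star_zero, Finset.sum_mul_sum, ite_mul, one_mul,
      zero_mul, ← ite_and]
    rw [Finset.sum_comm]
    refine Finset.sum_congr rfl fun i _ => ?_
    rw [Finset.sum_comm]
    refine Finset.sum_congr rfl fun j _ => ?_
    rw [Finset.sum_ite_one_eq_ite_exists _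
      fun u v hu hv => Subtype.ext (hu.1.left_unique hv.1)]
    refine if_congr ⟨fun ⟨u, hu⟩ => ⟨u.1, hu⟩, fun ⟨u, hu⟩ => ⟨⟨u, ?_⟩, hu⟩⟩ rfl rfl
    simp [Finset.mem_piAntidiag, ← hu.1.sum_eq, s.sum_eq]
  have h3 : ∀ i j, F i j = G j i + if i = j then F i i - G i i else 0 := by
    intro i j
    by_cases hij : i = j
    · subst hij
      simp
    · simp only [hF, hG, hij, if_false, add_zero]
      exact if_congr (exists_unitStep_comm_of_ne hij _ _) rfl rfl
  have h4 : ∑ i, F i i = ∑ i, G i i := by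
    rw [← Equiv.sum_comp (Equiv.addRight (1 : Fin r))]
    exact Finset.sum_congr rfl fun i _ => if_congr (exists_unitStep_self_comm i _ _) rfl rfl
  rw [h1, h2, Finset.sum_congr rfl fun i _ => Finset.sum_congr rfl fun j _ => h3 i j]
  simp only [Finset.sum_add_distrib, Finset.sum_ite_eq, Finset.mem_univ, if_true,
    Finset.sum_sub_distrib, h4, sub_self, add_zero]
  exact Finset.sum_comm

/-- The number of walks of length `m` that start at `c` in the graph of profiles. -/
def walkCount : ℕ → (Fin r → ℕ) → ℕ
  | 0, _ => 1
  | m + 1, c => ∑ i, if 0 < c i then walkCount m (moveUnit c i) else 0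

theorem profileMatrix_pow_mulVec (ℓ m : ℕ) (s : Profile r ℓ) :
    (profileMatrix r ℓ ^ m).mulVec (fun _ => 1) s = walkCount m s.1 := by
  classical
  induction m generalizing s with
  | zero => simp [walkCount]
  | succ m ih =>
    rw [pow_succ', ← Matrix.mulVec_mulVec, funext ih]
    simp only [Matrix.mulVec, dotProduct, profileMatrix, walkCount, Finset.sum_mul, ite_mul,
      one_mul, zero_mul, Nat.cast_sum, Nat.cast_ite, Nat.cast_zero]
    rw [Finset.sum_comm]
    refine Finset.sum_congr rfl fun i _ => ?_
    simp only [unitStep_iff]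
    split_ifs with h
    · have hm : moveUnit s.1 i ∈ Finset.piAntidiag (Finset.univ : Finset (Fin r)) ℓ := by
        simp [Finset.mem_piAntidiag, sum_moveUnit h, s.sum_eq]
      rw [Finset.sum_eq_single ⟨_, hm⟩]
      · simp [h]
      · intro t _ ht
        exact if_neg fun h' => ht (Subtype.ext h'.2)
      · simp
    · simp [h]

/-- Moves preserve the level, so all walks from `c` stay in one finite graph, where they are counted
by powers of a normal matrix applied to the all-ones vector. -/
theorem expSum_walkCount (c : Fin r → ℕ) : ExpSum fun m => (walkCount m c : ℂ) := by
  classical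
  have hm : c ∈ Finset.piAntidiag (Finset.univ : Finset (Fin r)) (∑ i, c i) := by
    simp [Finset.mem_piAntidiag]
  have := (profileMatrix r (∑ i, c i)).expSum_of_normal (profileMatrix_normal r _) (fun _ => 1)
    ⟨c, hm⟩
  simpa only [profileMatrix_pow_mulVec] using this

end ProfileGraph

/-! ### Removing and inserting the largest part. -/

namespace CylindricPartition

variable {r : ℕ} [NeZero r] {c : Fin r → ℕ}

theorem HasDistinctParts.eq {Λ : CylindricPartition c} (h : Λ.HasDistinctParts) {i i' : Fin r}
    {j j' n : ℕ} (h1 : Λ.part i j = n + 1) (h2 : Λ.part i' j' = n + 1) : i = i' ∧ j = j' :=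
  h i j i' j' (by omega) (h1.trans h2.symm)

/-- The cylindric partitions into distinct parts whose set of parts is `{n + 1 | n ∈ S}`. -/
def distinctWithParts (c : Fin r → ℕ) (S : Finset ℕ) : Set (CylindricPartition c) :=
  {Λ | Λ.HasDistinctParts ∧ ∀ n, n ∈ S ↔ ∃ i j, Λ.part i j = n + 1}

/-- The sequence `M, f 0, f 1, …`. -/
noncomputable def consSeq (M : ℕ) (f : ℕ →₀ ℕ) : ℕ →₀ ℕ :=
  Finsupp.onFinset (insert 0 (f.support.image Nat.succ)) (fun j => Nat.casesOn j M f) fun j hj => by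
    cases j with
    | zero => simp
    | succ j => simpa using hj

@[simp]
theorem consSeq_zero (M : ℕ) (f : ℕ →₀ ℕ) : consSeq M f 0 = M := rfl

@[simp]
theorem consSeq_succ (M : ℕ) (f : ℕ →₀ ℕ) (j : ℕ) : consSeq M f (j + 1) = f j := rfl

/-- The sequence `f 1, f 2, …`. -/
noncomputable def tailSeq (f : ℕ →₀ ℕ) : ℕ →₀ ℕ :=
  f.comapDomain Nat.succ Nat.succ_injective.injOn

@[simp]
theorem tailSeq_apply (f : ℕ →₀ ℕ) (j : ℕ) : tailSeq f j = f (j + 1) := rfl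

/-- Put a new part `M`, not smaller than all the others, in front of the `i`-th partition. -/
noncomputable def push (i : Fin r) (hi : 0 < c i) (M : ℕ) (Λ : CylindricPartition (moveUnit c i))
    (hM : ∀ k j, Λ.part k j ≤ M) : CylindricPartition c where
  part k := if k = i then consSeq M (Λ.part k) else Λ.part k
  antitone_part k := by
    split_ifs with hk
    · refine antitone_nat_of_succ_le fun j => ?_
      cases j with
      | zero => simpa using hM k 0
      | succ j => simpa using Λ.antitone_part k (Nat.le_succ j)
    · exact Λ.antitone_part k
  interlace k j := by
    have h0 : ∀ j, Λ.part (k + 1) (j + moveUnit c i (k + 1)) ≤ Λ.part k j := Λ.interlace k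
    have hm := (unitStep_iff.2 ⟨hi, rfl⟩ : UnitStep i c (moveUnit c i)).2 (k + 1)
    -- The index shift in partition `i` is offset by the change of the profile at `i` and `i + 1`,
    -- so each inequality is an old one or bounds an entry by the new part `M`.
    by_cases h2 : k = i
    · rw [if_pos h2, if_pos (congrArg (· + 1) h2)] at *
      by_cases h1 : k + 1 = i
      · rw [if_pos h1] at *
        have : c (k + 1) ≠ 0 := by rw [h1]; omega
        obtain ⟨d, hd⟩ := Nat.exists_eq_succ_of_ne_zero this
        have hmd : moveUnit c i (k + 1) = d + 1 := by omega
        cases j with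
        | zero =>
          rw [hd, Nat.zero_add, consSeq_succ, consSeq_zero]
          exact hM _ _
        | succ j =>
          rw [show j + 1 + c (k + 1) = (j + moveUnit c i (k + 1)) + 1 by omega, consSeq_succ,
            consSeq_succ]
          exact h0 j
      · rw [if_neg h1] at *
        cases j with
        | zero =>
          rw [consSeq_zero]
          exact hM _ _
        | succ j =>
          rw [show j + 1 + c (k + 1) = j + moveUnit c i (k + 1) by omega, consSeq_succ]
          exact h0 j
    · rw [if_neg h2, if_neg fun h => h2 (add_right_cancel h)] at *
      by_cases h1 : k + 1 = i
      · rw [if_pos h1] at *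
        rw [show j + c (k + 1) = (j + moveUnit c i (k + 1)) + 1 by omega, consSeq_succ]
        exact h0 j
      · rw [if_neg h1] at *
        rw [show j + c (k + 1) = j + moveUnit c i (k + 1) by omega]
        exact h0 j

/-- Remove the first part of the `i`-th partition. -/
noncomputable def pop (i : Fin r) (hi : 0 < c i) (Λ : CylindricPartition c) :
    CylindricPartition (moveUnit c i) where
  part k := if k = i then tailSeq (Λ.part k) else Λ.part k
  antitone_part k := by
    split_ifs with hk
    · exact fun a b hab => Λ.antitone_part k (Nat.succ_le_succ hab)
    · exact Λ.antitone_part k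
  interlace k j := by
    have h0 : ∀ j, Λ.part (k + 1) (j + c (k + 1)) ≤ Λ.part k j := Λ.interlace k
    have hm := (unitStep_iff.2 ⟨hi, rfl⟩ : UnitStep i c (moveUnit c i)).2 (k + 1)
    by_cases h2 : k = i
    · rw [if_pos h2, if_pos (congrArg (· + 1) h2)] at *
      rw [tailSeq_apply]
      by_cases h1 : k + 1 = i
      · rw [if_pos h1] at *
        rw [tailSeq_apply, show j + moveUnit c i (k + 1) + 1 = j + 1 + c (k + 1) by omega]
        exact h0 _
      · rw [if_neg h1] at *
        rw [show j + moveUnit c i (k + 1) = j + 1 + c (k + 1) by omega]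
        exact h0 _
    · rw [if_neg h2, if_neg fun h => h2 (add_right_cancel h)] at *
      by_cases h1 : k + 1 = i
      · rw [if_pos h1] at *
        rw [tailSeq_apply, show j + moveUnit c i (k + 1) + 1 = j + c (k + 1) by omega]
        exact h0 _
      · rw [if_neg h1] at *
        rw [show j + moveUnit c i (k + 1) = j + c (k + 1) by omega]
        exact h0 _

theorem push_part_self (i : Fin r) (hi : 0 < c i) (M : ℕ) (Λ : CylindricPartition (moveUnit c i))
    (hM : ∀ k j, Λ.part k j ≤ M) : (push i hi M Λ hM).part i = consSeq M (Λ.part i) :=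
  if_pos rfl

theorem push_part_of_ne {i k : Fin r} (hi : 0 < c i) (M : ℕ)
    (Λ : CylindricPartition (moveUnit c i)) (hM : ∀ k j, Λ.part k j ≤ M) (hk : k ≠ i) :
    (push i hi M Λ hM).part k = Λ.part k :=
  if_neg hk

theorem push_pop (i : Fin r) (hi : 0 < c i) (Λ : CylindricPartition c)
    (hM : ∀ k j, (pop i hi Λ).part k j ≤ Λ.part i 0) :
    push i hi (Λ.part i 0) (pop i hi Λ) hM = Λ := by
  ext k j
  by_cases hk : k = i
  · subst hk
    rw [push_part_self]
    cases j with
    | zero => rfl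
    | succ j => simp [pop]
  · rw [push_part_of_ne _ _ _ _ hk]
    simp [pop, hk]

theorem push_injective (i : Fin r) (hi : 0 < c i) (M : ℕ)
    {Λ Λ' : CylindricPartition (moveUnit c i)}
    (hM : ∀ k j, Λ.part k j ≤ M) (hM' : ∀ k j, Λ'.part k j ≤ M)
    (h : push i hi M Λ hM = push i hi M Λ' hM') : Λ = Λ' := by
  ext k j
  by_cases hk : k = i
  · subst hk
    have := congrArg (fun Λ : CylindricPartition c => Λ.part k (j + 1)) h
    simpa [push_part_self] using this
  · have := congrArg (fun Λ : CylindricPartition c => Λ.part k j) h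
    simpa [push_part_of_ne _ _ _ _ hk] using this

theorem push_part_eq_iff (i : Fin r) (hi : 0 < c i) (M : ℕ)
    (Λ : CylindricPartition (moveUnit c i)) (hM : ∀ k j, Λ.part k j ≤ M) (k : Fin r) (j p : ℕ) :
    (push i hi M Λ hM).part k j = p ↔
      (k = i ∧ j = 0 ∧ p = M) ∨
        ∃ j', Λ.part k j' = p ∧ j = if k = i then j' + 1 else j' := by
  by_cases hk : k = i
  · subst hk
    rw [push_part_self]
    cases j with
    | zero => simp [eq_comm]
    | succ j => simp
  · rw [push_part_of_ne _ _ _ _ hk]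
    simp [hk]

theorem part_le_of_mem_distinctWithParts {S : Finset ℕ} {a : ℕ} (ha : ∀ n ∈ S, n < a)
    {Λ : CylindricPartition c} (hΛ : Λ ∈ distinctWithParts c S) (k : Fin r) (j : ℕ) :
    Λ.part k j ≤ a := by
  rcases h : Λ.part k j with _ | n
  · exact Nat.zero_le _
  · exact ha n ((hΛ.2 n).2 ⟨k, j, h⟩)

theorem push_mem_distinctWithParts {S : Finset ℕ} {a : ℕ} (ha : ∀ n ∈ S, n < a) (i : Fin r)
    (hi : 0 < c i) {Λ : CylindricPartition (moveUnit c i)}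
    (hΛ : Λ ∈ distinctWithParts (moveUnit c i) S) (hM : ∀ k j, Λ.part k j ≤ a + 1) :
    push i hi (a + 1) Λ hM ∈ distinctWithParts c (insert a S) := by
  have hle := part_le_of_mem_distinctWithParts ha hΛ
  constructor
  · intro k j k' j' h0 h
    have h1 := (push_part_eq_iff i hi (a + 1) Λ hM k j _).1 rfl
    have h2 := (push_part_eq_iff i hi (a + 1) Λ hM k' j' _).1 h.symm
    rcases h1 with ⟨h1, h3, h4⟩ | ⟨l, h1, h3⟩ <;> rcases h2 with ⟨h2, h5, h6⟩ | ⟨l', h2, h5⟩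
    · exact ⟨h1.trans h2.symm, h3.trans h5.symm⟩
    · have := hle k' l'
      omega
    · have := hle k l
      omega
    · obtain ⟨rfl, rfl⟩ := hΛ.1 k l k' l' (by rwa [h1]) (h1.trans h2.symm)
      exact ⟨rfl, h3.trans h5.symm⟩
  · intro n
    rw [Finset.mem_insert, hΛ.2 n]
    constructor
    · rintro (rfl | ⟨k, j, h⟩)
      · exact ⟨i, 0, (push_part_eq_iff ..).2 (Or.inl ⟨rfl, rfl, rfl⟩)⟩
      · exact ⟨k, _, (push_part_eq_iff ..).2 (Or.inr ⟨j, h, rfl⟩)⟩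
    · rintro ⟨k, j, h⟩
      rcases (push_part_eq_iff ..).1 h with ⟨_, _, h⟩ | ⟨l, h, _⟩
      · exact Or.inl (by omega)
      · exact Or.inr ⟨k, l, h⟩

/-- The largest part of a cylindric partition into distinct parts comes first in its partition. -/
theorem exists_part_zero_eq {S : Finset ℕ} {a : ℕ} (ha : ∀ n ∈ S, n < a) (hc : 0 < ∑ i, c i)
    {Λ : CylindricPartition c} (hΛ : Λ ∈ distinctWithParts c (insert a S)) :
    ∃ i, 0 < c i ∧ Λ.part i 0 = a + 1 := by
  have hle : ∀ k j, Λ.part k j ≤ a + 1 := by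
    refine part_le_of_mem_distinctWithParts (fun n hn => ?_) hΛ
    rcases Finset.mem_insert.1 hn with rfl | hn
    · omega
    · have := ha n hn
      omega
  obtain ⟨i, j, hij⟩ := (hΛ.2 a).1 (Finset.mem_insert_self a S)
  have h0 : Λ.part i 0 = a + 1 :=
    le_antisymm (hle i 0) (hij ▸ Λ.antitone_part i (Nat.zero_le j))
  -- If `c i = 0`, interlacing makes the first entry of partition `i - 1` maximal too. Distinctness
  -- then forces `i - 1 = i`, so `r = 1` and the level is zero, against `hc`.
  refine ⟨i, Nat.pos_of_ne_zero fun hci => ?_, h0⟩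
  have h1 := Λ.interlace (i - 1) 0
  rw [sub_add_cancel, hci, Nat.add_zero, h0] at h1
  have h2 := (hΛ.1.eq (le_antisymm (hle (i - 1) 0) h1) h0).1
  have h3 : (1 : Fin r) = 0 := by simpa using h2
  have h4 : ∀ x : Fin r, x = i := by
    intro x
    have hr := NeZero.pos r
    rcases r with _ | _ | r
    · omega
    · exact Fin.ext (by have := x.isLt; have := i.isLt; omega)
    · simp at h3
  exact hc.ne' (Finset.sum_eq_zero fun k _ => by rw [h4 k, hci])

theorem pop_mem_distinctWithParts {S : Finset ℕ} {a : ℕ} (ha : ∀ n ∈ S, n < a) {i : Fin r}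
    (hi : 0 < c i) {Λ : CylindricPartition c} (hΛ : Λ ∈ distinctWithParts c (insert a S))
    (h0 : Λ.part i 0 = a + 1) : pop i hi Λ ∈ distinctWithParts (moveUnit c i) S := by
  have hp : ∀ k j, (pop i hi Λ).part k j = Λ.part k (if k = i then j + 1 else j) := by
    intro k j
    by_cases hk : k = i <;> simp [pop, hk]
  constructor
  · intro k j k' j' hne h
    rw [hp] at hne
    rw [hp, hp] at h
    obtain ⟨rfl, h2⟩ := hΛ.1 _ _ _ _ hne h
    refine ⟨rfl, ?_⟩
    split_ifs at h2 <;> omega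
  · intro n
    constructor
    · intro hn
      obtain ⟨k, j, h⟩ := (hΛ.2 n).1 (Finset.mem_insert_of_mem hn)
      by_cases hk : k = i
      · subst hk
        cases j with
        | zero =>
          have := ha n hn
          omega
        | succ j => exact ⟨k, j, by rw [hp, if_pos rfl, h]⟩
      · exact ⟨k, j, by rw [hp, if_neg hk, h]⟩
    · rintro ⟨k, j, h⟩
      rw [hp] at h
      rcases Finset.mem_insert.1 ((hΛ.2 n).2 ⟨k, _, h⟩) with rfl | hn
      · obtain ⟨rfl, h2⟩ := hΛ.1.eq h h0
        simp at h2
      · exact hn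

theorem part_eq_zero_of_mem_distinctWithParts_empty {Λ : CylindricPartition c}
    (h : Λ ∈ distinctWithParts c ∅) (k : Fin r) (j : ℕ) : Λ.part k j = 0 := by
  rcases hp : Λ.part k j with _ | n
  · rfl
  · exact absurd ((h.2 n).2 ⟨k, j, hp⟩) (Finset.notMem_empty n)

theorem distinctWithParts_empty (c : Fin r → ℕ) :
    ∃ Λ, distinctWithParts c ∅ = {Λ} := by
  refine ⟨⟨fun _ => 0, fun _ _ _ _ => le_rfl, fun _ _ => le_rfl⟩, ?_⟩
  refine Set.eq_singleton_iff_unique_mem.2 ⟨⟨fun _ _ _ _ h => absurd rfl h, by simp⟩, ?_⟩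
  intro Λ hΛ
  ext k j
  exact part_eq_zero_of_mem_distinctWithParts_empty hΛ k j

/-- The largest part singles out a position `i`, and popping it there is inverse to pushing. This
matches the recursion of `walkCount`, with the profile varying along the induction. Finiteness is
carried along so that the cardinality of the disjoint union is a sum. -/
theorem finite_and_card_distinctWithParts (S : Finset ℕ) (c : Fin r → ℕ) (hc : 0 < ∑ i, c i) :
    Finite (distinctWithParts c S) ∧
      Nat.card (distinctWithParts c S) = walkCount S.card c := by
  induction S using Finset.induction_on_max generalizing c with
  | empty =>
    obtain ⟨Λ, hΛ⟩ := distinctWithParts_empty c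
    rw [hΛ]
    exact ⟨inferInstance, by simp [walkCount]⟩
  | insert a S ha ih =>
    have hle : ∀ (i : Fin r) (Λ : distinctWithParts (moveUnit c i) S) (k j),
        Λ.1.part k j ≤ a + 1 := fun i Λ k j =>
      (part_le_of_mem_distinctWithParts ha Λ.2 k j).trans (Nat.le_succ a)
    let f : (Σ i : {i // 0 < c i}, distinctWithParts (moveUnit c i.1) S) →
        distinctWithParts c (insert a S) := fun x =>
      ⟨push x.1.1 x.1.2 (a + 1) x.2.1 (hle _ x.2), push_mem_distinctWithParts ha _ _ x.2.2 _⟩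
    have hf : Function.Bijective f := by
      constructor
      · rintro ⟨⟨i, hi⟩, Λ⟩ ⟨⟨i', hi'⟩, Λ'⟩ h
        have h : push i hi (a + 1) Λ.1 (hle _ Λ) = push i' hi' (a + 1) Λ'.1 (hle _ Λ') :=
          congrArg Subtype.val h
        have hd := (push_mem_distinctWithParts ha i hi Λ.2 (hle _ Λ)).1
        have h1 : (push i hi (a + 1) Λ.1 (hle _ Λ)).part i 0 = a + 1 := by
          rw [push_part_self, consSeq_zero]
        have h2 : (push i hi (a + 1) Λ.1 (hle _ Λ)).part i' 0 = a + 1 := by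
          rw [h, push_part_self, consSeq_zero]
        obtain ⟨rfl, -⟩ := hd.eq h1 h2
        rw [Subtype.ext (push_injective i hi (a + 1) (hle _ Λ) (hle _ Λ') h)]
      · rintro ⟨Λ, hΛ⟩
        obtain ⟨i, hi, h0⟩ := exists_part_zero_eq ha hc hΛ
        refine ⟨⟨⟨i, hi⟩, ⟨pop i hi Λ, pop_mem_distinctWithParts ha hi hΛ h0⟩⟩, Subtype.ext ?_⟩
        simp only [f, ← h0]
        exact push_pop i hi Λ _
    have hpos : ∀ i : {i // 0 < c i}, 0 < ∑ k, moveUnit c i.1 k := fun i => by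
      rwa [sum_moveUnit i.2]
    have : ∀ i : {i // 0 < c i}, Finite (distinctWithParts (moveUnit c i.1) S) :=
      fun i => (ih _ (hpos i)).1
    refine ⟨Finite.of_surjective f hf.2, ?_⟩
    rw [← Nat.card_congr (Equiv.ofBijective f hf), Nat.card_sigma,
      Finset.card_insert_of_notMem fun h => (ha a h).false, walkCount, ← Finset.sum_filter,
      Finset.sum_congr rfl fun i _ => (ih _ (hpos i)).2]
    exact (Finset.sum_subtype _ (fun i => by simp) fun i => walkCount S.card (moveUnit c i)).symm

/-! ### Counting by the set of parts. -/

/-- The set of the numbers `p - 1` where `p` is a part. -/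
noncomputable def predParts (Λ : CylindricPartition c) : Finset ℕ :=
  (Finset.univ.sigma fun i => (Λ.part i).support).image fun x => Λ.part x.1 x.2 - 1

theorem mem_predParts {Λ : CylindricPartition c} {n : ℕ} :
    n ∈ Λ.predParts ↔ ∃ i j, Λ.part i j = n + 1 := by
  simp only [predParts, Finset.mem_image, Finset.mem_sigma, Finset.mem_univ, true_and,
    Finsupp.mem_support_iff, Sigma.exists]
  exact exists_congr fun i => exists_congr fun j => by omega

theorem HasDistinctParts.size_eq {Λ : CylindricPartition c} (h : Λ.HasDistinctParts) :
    Λ.size = ∑ n ∈ Λ.predParts, (n + 1) := by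
  rw [predParts, Finset.sum_image, Finset.sum_sigma]
  · refine Finset.sum_congr rfl fun i _ => Finset.sum_congr rfl fun j hj => ?_
    have := Finsupp.mem_support_iff.1 hj
    dsimp only
    omega
  · rintro ⟨i, j⟩ hx ⟨i', j'⟩ hy hxy
    simp only [Finset.coe_sigma, Set.mem_sigma_iff, Finset.mem_coe, Finsupp.mem_support_iff] at hx hy
    dsimp only at hxy
    obtain ⟨rfl, rfl⟩ := h i j i' j' hx.2 (by omega)
    rfl

/-- Finite sets of natural numbers `S` with `∑ n ∈ S, (n + 1) = N`. -/
def finsetsOfWeight (N : ℕ) : Finset (Finset ℕ) :=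
  (Finset.range N).powerset.filter fun S => ∑ n ∈ S, (n + 1) = N

theorem mem_finsetsOfWeight {N : ℕ} {S : Finset ℕ} :
    S ∈ finsetsOfWeight N ↔ ∑ n ∈ S, (n + 1) = N := by
  rw [finsetsOfWeight, Finset.mem_filter, Finset.mem_powerset, and_iff_right_iff_imp]
  rintro rfl n hn
  have := Finset.single_le_sum (f := fun n => n + 1) (fun _ _ => Nat.zero_le _) hn
  exact Finset.mem_range.2 this

theorem distinctCount_eq (c : Fin r → ℕ) (hc : 0 < ∑ i, c i) (N : ℕ) :
    distinctCount c N = ∑ S ∈ finsetsOfWeight N, walkCount S.card c := by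
  classical
  have hfin : {Λ : CylindricPartition c | Λ.size = N ∧ Λ.HasDistinctParts}.Finite :=
    (finite_size_eq c N).subset fun Λ h => h.1
  rw [distinctCount, Set.ncard_eq_toFinset_card _ hfin,
    Finset.card_eq_sum_card_fiberwise (f := predParts) (t := finsetsOfWeight N)]
  · refine Finset.sum_congr rfl fun S hS => ?_
    rw [← (finite_and_card_distinctWithParts S c hc).2, Nat.card_coe_set_eq,
      ← Set.ncard_coe_finset]
    congr 1
    ext Λ
    simp only [Finset.coe_filter, Set.Finite.mem_toFinset, Set.mem_ofPred_eq, distinctWithParts]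
    constructor
    · rintro ⟨⟨-, h⟩, rfl⟩
      exact ⟨h, fun n => mem_predParts⟩
    · rintro ⟨h, h'⟩
      have : Λ.predParts = S := Finset.ext fun n => mem_predParts.trans (h' n).symm
      exact ⟨⟨by rw [h.size_eq, this, mem_finsetsOfWeight.1 hS], h⟩, this⟩
  · intro Λ hΛ
    have hΛ : Λ.size = N ∧ Λ.HasDistinctParts := by simpa using hΛ
    exact mem_finsetsOfWeight.2 (hΛ.2.size_eq.symm.trans hΛ.1)

end CylindricPartition

/-! ### Euler derivatives of the product and Lambert series. -/

section LambertSeries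

/-- The factors are nonzero and tend to `1`, so their inverses are bounded. -/
theorem exists_forall_le_norm_one_add (w : ℂ) {q : ℂ} (hq : ‖q‖ < 1)
    (hw : ∀ n : ℕ, 1 + w * q ^ (n + 1) ≠ 0) : ∃ d > 0, ∀ n : ℕ, d ≤ ‖1 + w * q ^ (n + 1)‖ := by
  have h1 : Filter.Tendsto (fun n : ℕ => ‖1 + w * q ^ (n + 1)‖⁻¹) Filter.atTop (nhds 1) := by
    have h0 := (((tendsto_pow_atTop_nhds_zero_of_norm_lt_one hq).comp
      (Filter.tendsto_add_atTop_nat 1)).const_mul w).const_add 1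
    simpa using h0.norm.inv₀ (by simp)
  obtain ⟨C, hC⟩ := h1.bddAbove_range
  have hC' : ∀ n : ℕ, ‖1 + w * q ^ (n + 1)‖⁻¹ ≤ C := fun n => hC ⟨n, rfl⟩
  have hC0 : 0 < C := (inv_pos.2 (norm_pos_iff.2 (hw 0))).trans_le (hC' 0)
  refine ⟨C⁻¹, inv_pos.2 hC0, fun n => ?_⟩
  exact inv_le_of_inv_le₀ (norm_pos_iff.2 (hw n)) (hC' n)

theorem exists_ball_le_norm_one_add (w : ℂ) {q : ℂ} (hq : ‖q‖ < 1)
    (hw : ∀ n : ℕ, 1 + w * q ^ (n + 1) ≠ 0) :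
    ∃ ε > 0, ∃ d > 0, ∀ v ∈ Metric.ball w ε, ∀ n : ℕ, d ≤ ‖1 + v * q ^ (n + 1)‖ := by
  obtain ⟨d, hd, h⟩ := exists_forall_le_norm_one_add w hq hw
  refine ⟨d / 2, by positivity, d / 2, by positivity, fun v hv n => ?_⟩
  have h1 : ‖(w - v) * q ^ (n + 1)‖ ≤ d / 2 := by
    rw [norm_mul, norm_pow, norm_sub_rev]
    have h2 : ‖v - w‖ ≤ d / 2 := (mem_ball_iff_norm.1 hv).le
    have h3 : ‖q‖ ^ (n + 1) ≤ 1 := pow_le_one₀ (norm_nonneg _) hq.le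
    nlinarith [norm_nonneg (v - w), pow_nonneg (norm_nonneg q) (n + 1)]
  have h2 := norm_sub_norm_le (1 + w * q ^ (n + 1)) ((w - v) * q ^ (n + 1))
  have h3 : 1 + w * q ^ (n + 1) - (w - v) * q ^ (n + 1) = 1 + v * q ^ (n + 1) := by ring
  rw [h3] at h2
  linarith [h n]

theorem hasDerivAt_lambertTerm (j : ℕ) {v x : ℂ} (h : 1 + v * x ≠ 0) :
    HasDerivAt (fun v => (v * x / (1 + v * x)) ^ (j + 1))
      ((j + 1) * (v * x / (1 + v * x)) ^ j * (x / (1 + v * x) ^ 2)) v := by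
  have h1 : HasDerivAt (fun v => v * x) x v := by simpa using (hasDerivAt_id v).mul_const x
  convert! (h1.fun_div (h1.const_add 1) h).fun_pow (j + 1) using 1
  push_cast
  congr 2
  ring

/-- For `y = wx / (1 + wx)` one has `w dy/dw = y - y ^ 2`, whence `w d(y ^ j)/dw = j (y ^ j - y ^ (j
+ 1))`. Termwise differentiation is justified by a geometric bound on a ball where the denominators
stay away from zero. -/
theorem hasDerivAt_lambertSeries (j : ℕ) (w : ℂ) {q : ℂ} (hq : ‖q‖ < 1)
    (hw : ∀ n : ℕ, 1 + w * q ^ (n + 1) ≠ 0) :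
    ∃ D, HasDerivAt (fun v => lambertSeries (j + 1) v q) D w ∧
      w * D = (j + 1) * (lambertSeries (j + 1) w q - lambertSeries (j + 2) w q) := by
  obtain ⟨ε, hε, d, hd, hdb⟩ := exists_ball_le_norm_one_add w hq hw
  have hne : ∀ v ∈ Metric.ball w ε, ∀ n : ℕ, 1 + v * q ^ (n + 1) ≠ 0 := fun v hv n h => by
    have := hdb v hv n
    rw [h, norm_zero] at this
    linarith
  have hgeo : Summable fun n : ℕ => ‖q‖ ^ (n + 1) :=
    (summable_nat_add_iff 1).2 (summable_geometric_of_lt_one (norm_nonneg q) hq)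
  set R : ℝ := (‖w‖ + ε) / d with hR
  have hR0 : 0 ≤ R := by positivity
  have hy : ∀ v ∈ Metric.ball w ε, ∀ n : ℕ, ‖v * q ^ (n + 1) / (1 + v * q ^ (n + 1))‖ ≤ R := by
    intro v hv n
    have h2 : ‖v‖ ≤ ‖w‖ + ε := by
      have := norm_sub_norm_le v w
      have := mem_ball_iff_norm.1 hv
      linarith
    have h3 : ‖q‖ ^ (n + 1) ≤ 1 := pow_le_one₀ (norm_nonneg _) hq.le
    rw [norm_div, hR, norm_mul, norm_pow]
    have := mul_le_of_le_one_right (norm_nonneg v) h3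
    gcongr
    · linarith
    · exact hdb v hv n
  have hder := hasDerivAt_tsum_of_isPreconnected
    (u := fun n : ℕ => (j + 1) * R ^ j / d ^ 2 * ‖q‖ ^ (n + 1))
    (g := fun (n : ℕ) v => (v * q ^ (n + 1) / (1 + v * q ^ (n + 1))) ^ (j + 1))
    (g' := fun (n : ℕ) v => (j + 1) * (v * q ^ (n + 1) / (1 + v * q ^ (n + 1))) ^ j *
      (q ^ (n + 1) / (1 + v * q ^ (n + 1)) ^ 2))
    (hgeo.mul_left _) Metric.isOpen_ball (convex_ball w ε).isPreconnected
    (fun n v hv => hasDerivAt_lambertTerm j (hne v hv n))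
    (fun n v hv => by
      rw [norm_mul, norm_mul, norm_div, norm_pow, norm_pow, norm_pow]
      have h1 : ‖(j + 1 : ℂ)‖ = j + 1 := by
        rw [← Nat.cast_add_one, Complex.norm_natCast]
        push_cast
        rfl
      rw [h1]
      have h2 := hy v hv n
      have h3 := hdb v hv n
      calc _ ≤ ((j : ℝ) + 1) * R ^ j * (‖q‖ ^ (n + 1) / d ^ 2) := by gcongr
        _ = _ := by ring)
    (Metric.mem_ball_self hε) (summable_lambertSeries (Nat.le_add_left 1 j) w hq)
    (Metric.mem_ball_self hε)
  refine ⟨_, hder, ?_⟩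
  rw [lambertSeries, lambertSeries,
    ← (summable_lambertSeries (Nat.le_add_left 1 j) w hq).tsum_sub
      (summable_lambertSeries (Nat.le_add_left 1 (j + 1)) w hq), ← tsum_mul_left, ← tsum_mul_left]
  refine tsum_congr fun n => ?_
  have := hw n
  rw [div_pow, div_pow, div_pow]
  field_simp
  ring

theorem qPochhammerInf_neg_mul (w q : ℂ) :
    qPochhammerInf (-(w * q)) q = ∏' n : ℕ, (1 + w * q ^ (n + 1)) :=
  tprod_congr fun n => by ring

theorem qPochhammerInf_neg_mul_ne_zero (w : ℂ) {q : ℂ} (hq : ‖q‖ < 1)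
    (hw : ∀ n : ℕ, 1 + w * q ^ (n + 1) ≠ 0) : qPochhammerInf (-(w * q)) q ≠ 0 := by
  rw [qPochhammerInf_neg_mul]
  refine tprod_one_add_ne_zero_of_summable hw ?_
  simp only [norm_mul, norm_pow]
  exact ((summable_nat_add_iff 1).2 (summable_geometric_of_lt_one (norm_nonneg q) hq)).mul_left _

theorem differentiable_qPochhammerInf_neg_mul {q : ℂ} (hq : ‖q‖ < 1) :
    Differentiable ℂ fun w => qPochhammerInf (-(w * q)) q :=
  (differentiable_qPochhammerInf hq).comp (f := fun w => -(w * q)) (by fun_prop)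

/-- The logarithmic derivative of a locally uniformly convergent product is the sum of those of its
factors. -/
theorem mul_deriv_qPochhammerInf (w : ℂ) {q : ℂ} (hq : ‖q‖ < 1)
    (hw : ∀ n : ℕ, 1 + w * q ^ (n + 1) ≠ 0) :
    w * deriv (fun w => qPochhammerInf (-(w * q)) q) w =
      qPochhammerInf (-(w * q)) q * lambertSeries 1 w q := by
  have hgeo : Summable fun n : ℕ => ‖q‖ ^ (n + 1) :=
    (summable_nat_add_iff 1).2 (summable_geometric_of_lt_one (norm_nonneg q) hq)
  have hlog : ∀ n : ℕ, logDeriv (fun v => 1 + v * q ^ (n + 1)) w =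
      q ^ (n + 1) / (1 + w * q ^ (n + 1)) := by
    intro n
    have : HasDerivAt (fun v => 1 + v * q ^ (n + 1)) (q ^ (n + 1)) w := by
      simpa using ((hasDerivAt_id w).mul_const (q ^ (n + 1))).const_add 1
    rw [logDeriv_apply, this.deriv]
  obtain ⟨d, hd, h⟩ := exists_forall_le_norm_one_add w hq hw
  have hprod : MultipliableLocallyUniformlyOn (fun (n : ℕ) (v : ℂ) => 1 + v * q ^ (n + 1))
      (Metric.ball (0 : ℂ) (‖w‖ + 1)) := by
    refine (Summable.hasProdLocallyUniformlyOn_nat_one_add Metric.isOpen_ball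
      (u := fun n => (‖w‖ + 1) * ‖q‖ ^ (n + 1)) (hgeo.mul_left _) ?_ ?_).multipliableLocallyUniformlyOn
    · refine Filter.Eventually.of_forall fun n x hx => ?_
      rw [norm_mul, norm_pow]
      have : ‖x‖ ≤ ‖w‖ + 1 := by simpa using (mem_ball_zero_iff.1 hx).le
      gcongr
    · intro n
      fun_prop
  have key := logDeriv_tprod_eq_tsum (f := fun (n : ℕ) (v : ℂ) => 1 + v * q ^ (n + 1))
    Metric.isOpen_ball (x := w) (by simp) hw (fun n => by fun_prop)
    (by
      simp only [hlog]
      refine Summable.of_norm_bounded (hgeo.mul_left d⁻¹) fun n => ?_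
      rw [norm_div, norm_pow, div_eq_inv_mul]
      have := h n
      gcongr) hprod
    (by rw [← qPochhammerInf_neg_mul]; exact qPochhammerInf_neg_mul_ne_zero w hq hw)
  simp only [hlog, ← qPochhammerInf_neg_mul] at key
  rw [logDeriv_apply, div_eq_iff (qPochhammerInf_neg_mul_ne_zero w hq hw)] at key
  rw [key, lambertSeries, ← mul_assoc, ← tsum_mul_left, mul_comm]
  congr 1
  exact tsum_congr fun n => by ring

/-- Polynomials in the first `m` Lambert series are mapped by `w d/dw` to polynomials in the first
`m + 1` Lambert series. -/
theorem MvPolynomial.exists_hasDerivAt_aeval_lambertSeries {m : ℕ} (P : MvPolynomial (Fin m) ℤ) :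
    ∃ Q : MvPolynomial (Fin (m + 1)) ℤ, ∀ w q : ℂ, ‖q‖ < 1 →
      (∀ n : ℕ, 1 + w * q ^ (n + 1) ≠ 0) →
      ∃ D, HasDerivAt
          (fun v => MvPolynomial.aeval (fun j : Fin m => lambertSeries (j + 1) v q) P) D w ∧
        w * D = MvPolynomial.aeval (fun j : Fin (m + 1) => lambertSeries (j + 1) w q) Q := by
  induction P using MvPolynomial.induction_on with
  | C a =>
    refine ⟨0, fun w q hq hw => ⟨0, ?_, by simp⟩⟩
    simpa using hasDerivAt_const w (a : ℂ)
  | add P P' h h' =>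
    obtain ⟨Q, h⟩ := h
    obtain ⟨Q', h'⟩ := h'
    refine ⟨Q + Q', fun w q hq hw => ?_⟩
    obtain ⟨D, h1, h2⟩ := h w q hq hw
    obtain ⟨D', h1', h2'⟩ := h' w q hq hw
    refine ⟨D + D', ?_, by rw [map_add, mul_add, h2, h2']⟩
    simpa only [map_add] using h1.fun_add h1'
  | mul_X P j h =>
    obtain ⟨Q, h⟩ := h
    -- Product rule: `X j` stands for `L_{j+1}`, whose Euler derivative is `(j + 1) (L_{j+1} -
    -- L_{j+2})`.
    refine ⟨Q * MvPolynomial.X j.castSucc + MvPolynomial.rename Fin.castSucc P *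
      (((j : ℕ) + 1 : MvPolynomial (Fin (m + 1)) ℤ) * (MvPolynomial.X j.castSucc - MvPolynomial.X j.succ)), fun w q hq hw => ?_⟩
    obtain ⟨D, h1, h2⟩ := h w q hq hw
    obtain ⟨D', h1', h2'⟩ := hasDerivAt_lambertSeries j w hq hw
    refine ⟨_, by simpa only [map_mul, MvPolynomial.aeval_X] using h1.fun_mul h1', ?_⟩
    rw [mul_add, ← mul_assoc, h2, mul_left_comm, h2']
    simp [MvPolynomial.aeval_rename, Function.comp_def, add_assoc, one_add_one_eq_two]

theorem exists_zDeriv_iterate_qPochhammerInf_eq (m : ℕ) : ∃ P : MvPolynomial (Fin m) ℤ,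
    ∀ w q : ℂ, ‖q‖ < 1 → (∀ n : ℕ, 1 + w * q ^ (n + 1) ≠ 0) →
      (zDeriv^[m] fun v => qPochhammerInf (-(v * q)) q) w = qPochhammerInf (-(w * q)) q *
        MvPolynomial.aeval (fun j : Fin m => lambertSeries (j + 1) w q) P := by
  induction m with
  | zero => exact ⟨1, fun w q hq hw => by simp⟩
  | succ m ih =>
    obtain ⟨P, hP⟩ := ih
    obtain ⟨Q, hQ⟩ := P.exists_hasDerivAt_aeval_lambertSeries
    -- The product contributes a factor `L_1`, which is `X 0`; `Q` is the Euler derivative of `P`.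
    refine ⟨MvPolynomial.X 0 * MvPolynomial.rename Fin.castSucc P + Q, fun w q hq hw => ?_⟩
    obtain ⟨D, h1, h2⟩ := hQ w q hq hw
    obtain ⟨ε, hε, d, hd, hdb⟩ := exists_ball_le_norm_one_add w hq hw
    have hev : (zDeriv^[m] fun v => qPochhammerInf (-(v * q)) q) =ᶠ[nhds w] fun v =>
        qPochhammerInf (-(v * q)) q *
          MvPolynomial.aeval (fun j : Fin m => lambertSeries (j + 1) v q) P := by
      filter_upwards [Metric.ball_mem_nhds w hε] with v hv
      refine hP v q hq fun n h => ?_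
      have := hdb v hv n
      rw [h, norm_zero] at this
      linarith
    have hd := ((differentiable_qPochhammerInf_neg_mul hq) w).hasDerivAt.fun_mul h1
    rw [Function.iterate_succ_apply', zDeriv, hev.deriv_eq, hd.deriv, mul_add, ← mul_assoc,
      mul_deriv_qPochhammerInf w hq hw, mul_left_comm, h2]
    simp [MvPolynomial.aeval_rename, Function.comp_def]
    ring

/-- The Euler operator commutes with dilations, so `β` can be absorbed into the variable. -/
theorem zDeriv_iterate_comp_mul_left (β : ℂ) (m : ℕ) (f : ℂ → ℂ) :
    (zDeriv^[m] fun z => f (β * z)) = fun z => (zDeriv^[m] f) (β * z) := by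
  induction m with
  | zero => rfl
  | succ m ih =>
    ext z
    rw [Function.iterate_succ_apply', Function.iterate_succ_apply', ih, zDeriv, zDeriv,
      deriv_comp_mul_left, smul_eq_mul]
    ring

theorem exists_productTerm_eq (m : ℕ) : ∃ P : MvPolynomial (Fin m) ℤ,
    ∀ β q : ℂ, ‖q‖ < 1 → (∀ n : ℕ, 1 + β * q ^ (n + 1) ≠ 0) →
      productTerm m β q = qPochhammerInf (-(β * q)) q *
        MvPolynomial.aeval (fun j : Fin m => lambertSeries (j + 1) β q) P := by
  obtain ⟨P, hP⟩ := exists_zDeriv_iterate_qPochhammerInf_eq m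
  refine ⟨P, fun β q hq hβ => ?_⟩
  rw [← hP β q hq hβ, productTerm,
    zDeriv_iterate_comp_mul_left β m fun w => qPochhammerInf (-(w * q)) q]
  simp only [mul_one]

end LambertSeries

/-! ### The generating function. -/

/-- Expand `∏ (1 + β q ^ (n + 1))` by choosing the finite set `S` of factors that contribute `β q ^
(n + 1)`. -/
theorem hasSum_finset_qPochhammerInf (β : ℂ) {q : ℂ} (hq : ‖q‖ < 1) :
    HasSum (fun S : Finset ℕ => β ^ S.card * q ^ ∑ n ∈ S, (n + 1))
      (qPochhammerInf (-(β * q)) q) := by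
  have hs : Summable fun n : ℕ => ‖β * q ^ (n + 1)‖ := by
    simp only [norm_mul, norm_pow]
    exact ((summable_nat_add_iff 1).2
      (summable_geometric_of_lt_one (norm_nonneg q) hq)).mul_left _
  have h := summable_finsetProd_of_summable_norm hs
  rw [qPochhammerInf_neg_mul, tprod_one_add h]
  simpa only [Finset.prod_mul_distrib, Finset.prod_const, Finset.prod_pow_eq_pow_sum] using h.hasSum

theorem productTerm_zero (β q : ℂ) : productTerm 0 β q = qPochhammerInf (-(β * q)) q := by
  simp [productTerm]

theorem hasSum_distinctCount {r : ℕ} [NeZero r] (c : Fin r → ℕ) (hc : 0 < ∑ i, c i) :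
    ∃ (N : ℕ) (a b : ℕ → ℂ), ∀ q : ℂ, ‖q‖ < 1 →
      HasSum (fun n : ℕ => (CylindricPartition.distinctCount c n : ℂ) * q ^ n)
        (∑ i ∈ Finset.range N, a i * productTerm 0 (b i) q) := by
  obtain ⟨N, a, b, h⟩ := expSum_walkCount c
  refine ⟨N, a, b, fun q hq => ?_⟩
  have h1 : HasSum (fun S : Finset ℕ => (walkCount S.card c : ℂ) * q ^ ∑ n ∈ S, (n + 1))
      (∑ i ∈ Finset.range N, a i * productTerm 0 (b i) q) := by
    have := hasSum_sum fun i (_ : i ∈ Finset.range N) =>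
      (hasSum_finset_qPochhammerInf (b i) hq).mul_left (a i)
    simpa only [productTerm_zero, h, Finset.sum_mul, mul_assoc] using this
  -- Grouping the finite sets by weight turns the sum over sets of parts into a power series in `q`.
  have h2 := h1.tsum_fiberwise fun S : Finset ℕ => (∑ n ∈ S, (n + 1) : ℕ)
  have h3 : ∀ n : ℕ, (∑' S : (fun S : Finset ℕ => ∑ n ∈ S, (n + 1)) ⁻¹' {n},
      (walkCount S.1.card c : ℂ) * q ^ ∑ n ∈ S.1, (n + 1)) =
      CylindricPartition.distinctCount c n * q ^ n := by
    intro n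
    have hfib : (fun S : Finset ℕ => ∑ n ∈ S, (n + 1)) ⁻¹' {n} =
        (CylindricPartition.finsetsOfWeight n : Set (Finset ℕ)) := by
      ext S
      simp [CylindricPartition.mem_finsetsOfWeight]
    rw [hfib, Finset.tsum_subtype' (CylindricPartition.finsetsOfWeight n)
      fun S => (walkCount S.card c : ℂ) * q ^ ∑ n ∈ S, (n + 1),
      CylindricPartition.distinctCount_eq c hc, Nat.cast_sum, Finset.sum_mul]
    refine Finset.sum_congr rfl fun S hS => ?_
    rw [CylindricPartition.mem_finsetsOfWeight.1 hS]
  simpa only [h3] using h2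

theorem mainTheorem2 {r : ℕ} [NeZero r] (c : Fin r → ℕ) (hc : 0 < ∑ i, c i) :
    (∃ (rg : Polynomial ℂ) (k : ℕ) (B : ℕ → ℕ) (α β : ℕ → ℕ → ℂ),
      ∀ q : ℂ, ‖q‖ < 1 →
        HasSum (fun n : ℕ => (CylindricPartition.distinctCount c n : ℂ) * q ^ n)
          (rg.eval q + ∑ m ∈ Finset.range (k + 1), ∑ i ∈ Finset.range (B m),
            α m i * productTerm m (β m i) q)) ∧
    (∀ m : ℕ, ∃ P : MvPolynomial (Fin m) ℤ,
      ∀ β q : ℂ, ‖q‖ < 1 → (∀ n : ℕ, 1 + β * q ^ (n + 1) ≠ 0) →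
        productTerm m β q = qPochhammerInf (-(β * q)) q *
          MvPolynomial.aeval (fun j : Fin m => lambertSeries (j + 1) β q) P) := by
  obtain ⟨N, a, b, h⟩ := hasSum_distinctCount c hc
  -- Diagonalizability excludes terms `m ^ d * b ^ m` with `d > 0`, so no derivatives occur; an
  -- eigenvalue `0` just gives the constant product `1`.
  refine ⟨⟨0, 0, fun _ => N, fun _ => a, fun _ => b, fun q hq => ?_⟩, exists_productTerm_eq⟩
  simpa using h q hq
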